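/- All vector spaces are over $\mathbb C$. For a vector space $W$ let $\mathcal E(W)=\operatorname{Hom}(W,W((x)))\subset(\operatorname{End}W)[[x,x^{-1}]]$, and let $1_W\in\mathcal E(W)$ be the identity operator. **Local and closed subspaces.** Let $G\le\mathbb C^\times$ be a subgroup. A subset $S\subset\mathcal E(W)$ is *$G$-local* if for all $a,b\in S$ there are $\alpha_1,\dots,\alpha_r\in G$ with $\prod_i(x_1-\alpha_ix_2)\,[a(x_1),b(x_2)]=0$. It is *quasi-local* if for all $a,b\in S$ there is a nonzero polynomial $p$ with $$p(x_1,x_2)a(x_1)b(x_2)=p(x_1,x_2)b(x_2)a(x_1).$$ For such $a,b,p$ define $a(x)_nb(x)\in\mathcal E(W)$, $n\in\mathbb Z$, by $$Y_{\mathcal E}(a(x),x_0)b(x)=\sum_{n\in\mathbb Z}a(x)_nb(x)\,x_0^{-n-1}=\iota_{x,x_0}\big(1/p(x+x_0,x)\big)\,\big(p(x_1,x)a(x_1)b(x)\big)\big|_{x_1=x+x_0},$$ where powers of $x+x_0$ are expanded in nonnegative powers of $x_0$ and $\iota_{x,x_0}$ is the inclusion of $\mathbb C(x,x_0)$ into $\mathbb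 C((x))((x_0))$ (the result does not depend on $p$). A quasi-local subspace $U$ is *closed* if $a(x)_nb(x)\in U$ for all $a,b\in U$, $n\in\mathbb Z$. **$\Gamma$-vertex algebras and quasimodules.** Let $\Gamma$ be a group. A *$\Gamma$-vertex algebra* is a vertex algebra $(V,\mathbf 1,Y)$ with group homomorphisms $R:\Gamma\to GL(V)$, $g\mapsto R_g$, and $\phi:\Gamma\to\mathbb C^\times$ such that $R_g\mathbf 1=\mathbf 1$ and $R_gY(v,x)R_g^{-1}=Y(R_gv,\phi(g)^{-1}x)$ for $g\in\Gamma$, $v\in V$. A *$V$-quasimodule* is a vector space $W$ with a linear map $Y_W:V\to\mathcal E(W)$, $v\mapsto Y_W(v,x)$, such that * $Y_W(\mathbf 1,x)=1_W$; * for all $u,v\in V$ there is a nonzero polynomial $p(x_1,x_2)$ with $$x_0^{-1}\delta\!\left(\tfrac{x_1-x_2}{x_0}\right)p(x_1,x_2)Y_W(u,x_1)Y_W(v,x_2)-x_0^{-1}\delta\!\left(\tfrac{x_2-x_1}{-x_0}\right)p(x_1,x_2)Y_W(v,x_2)Y_W(u,x_1)=x_2^{-1}\delta\!\left(\tfrac{x_1-x_0}{x_2}\right)p(x_1,x_2)Y_W(Y(u,x_0)v,x_2);$$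 * $Y_W(R_gv,x)=Y_W(v,\phi(g)x)$ for all $g\in\Gamma$, $v\in V$; * for all $u,v\in V$, $Y_W(u,x)$ and $Y_W(v,x)$ satisfy $\prod_i(x_1-\alpha_ix_2)[Y_W(u,x_1),Y_W(v,x_2)]=0$ for some $\alpha_1,\dots,\alpha_k\in\phi(\Gamma)$. **Proposition.** Let $V$ be a $\Gamma$-vertex algebra, $W$ a vector space, and $Y_W:V\to\mathcal E(W)$ a linear map with $Y_W(\mathbf 1,x)=1_W$. Set $\overline V=\{Y_W(v,x)\mid v\in V\}\subset\mathcal E(W)$. Then $(W,Y_W)$ is a $V$-quasimodule if and only if 1. $\overline V$ is $\phi(\Gamma)$-local, 2. $\overline V$ is closed and $Y_W$ is a homomorphism from $V$ to $(\overline V,1_W,Y_{\mathcal E})$, i.e. it sends $\mathbf 1$ to $1_W$ and $Y(u,x_0)v$ to $Y_{\mathcal E}(Y_W(u,x),x_0)Y_W(v,x)$ for all $u,v\in V$, and 3. $Y_W(R_gv,x)=Y_W(v,\phi(g)x)$ for all $g\in\Gamma$, $v\in V$. In this case $(\overline V,1_W,Y_{\mathcal E})$ is a vertex algebra, so that $Y_W$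 is a homomorphism of vertex algebras. -/

import Mathlib

noncomputable section

namespace VAlg

/-! ## Formal series in several variables, given by their coefficients

`A : ℤ → ℤ → M` stands for `∑ A s t x₁ ^ s x₂ ^ t`, and `D : ℤ → ℤ → ℤ → M` stands for
`∑ D a b c x₀ ^ a x₁ ^ b x₂ ^ c`. -/

section FormalSeries

variable {M : Type*} [AddCommGroup M]

/-- The product `p(x₁, x₂) A(x₁, x₂)`; the variable `0` of `p` is `x₁`, the variable `1` is `x₂`. -/
def polyMul [Module ℂ M] (p : MvPolynomial (Fin 2) ℂ) (A : ℤ → ℤ → M) : ℤ → ℤ → M :=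
  fun s t => ∑ d ∈ p.support, p.coeff d • A (s - d 0) (t - d 1)

/-- `x₀⁻¹ δ((x₁ - x₂) / x₀) A(x₁, x₂) = ∑ₙ x₀ ^ (-n-1) (x₁ - x₂) ^ n A(x₁, x₂)`, where
`(x₁ - x₂) ^ n` is expanded in nonnegative powers of `x₂`. -/
def delta₁ (A : ℤ → ℤ → M) : ℤ → ℤ → ℤ → M := fun a b c =>
  ∑ᶠ i : ℕ, ((-1) ^ i * Ring.choose (-a - 1) i : ℤ) • A (b - (-a - 1) + i) (c - i)

/-- `x₀⁻¹ δ((x₂ - x₁) / (-x₀)) B(x₁, x₂) = ∑ₙ (-1) ^ n x₀ ^ (-n-1) (x₂ - x₁) ^ n B(x₁, x₂)`, where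
`(x₂ - x₁) ^ n` is expanded in nonnegative powers of `x₁`. -/
def delta₂ (B : ℤ → ℤ → M) : ℤ → ℤ → ℤ → M := fun a b c =>
  ∑ᶠ i : ℕ, ((Int.negOnePow (-a - 1) : ℤ) * (-1) ^ i * Ring.choose (-a - 1) i : ℤ) •
    B (b - i) (c - (-a - 1) + i)

/-- `x₂⁻¹ δ((x₁ - x₀) / x₂) C(x₀, x₂) = ∑ₙ x₂ ^ (-n-1) (x₁ - x₀) ^ n C(x₀, x₂)`, where
`(x₁ - x₀) ^ n` is expanded in nonnegative powers of `x₀`. The term `i` of the expansion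
contributes to `x₁ ^ b` for `n = b + i`. -/
def delta₃ (C : ℤ → ℤ → M) : ℤ → ℤ → ℤ → M := fun a b c =>
  ∑ᶠ i : ℕ, ((-1) ^ i * Ring.choose (b + i) i : ℤ) • C (a - i) (c + (b + i) + 1)

end FormalSeries

/-! ## Vertex algebras -/

/-- The data of a vertex algebra on `V`: a vacuum vector, and the products `u_n v`, where
`Y(u, x) v = ∑ₙ u_n v x ^ (-n-1)`. -/
structure VertexData (V : Type*) where
  one : V
  nprod : V → ℤ → V → V

/-- The vertex algebra axioms over `ℂ`: `Y` is a linear map from `V` to `Hom(V, V((x)))`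
(the first five fields), the vacuum and creation properties, and the Jacobi identity. -/
structure VertexData.IsVertexAlgebra {V : Type*} [AddCommGroup V] [Module ℂ V]
    (D : VertexData V) : Prop where
  add_nprod : ∀ u u' n v, D.nprod (u + u') n v = D.nprod u n v + D.nprod u' n v
  smul_nprod : ∀ (r : ℂ) u n v, D.nprod (r • u) n v = r • D.nprod u n v
  nprod_add : ∀ u n v v', D.nprod u n (v + v') = D.nprod u n v + D.nprod u n v'
  nprod_smul : ∀ (r : ℂ) u n v, D.nprod u n (r • v) = r • D.nprod u n v
  truncation : ∀ u v, ∃ N : ℤ, ∀ n, N ≤ n → D.nprod u n v = 0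
  one_nprod : ∀ n v, D.nprod D.one n v = if n = -1 then v else 0
  nprod_one : ∀ v n, 0 ≤ n → D.nprod v n D.one = 0
  nprod_neg_one_one : ∀ v, D.nprod v (-1) D.one = v
  jacobi : ∀ u v w a b c,
    delta₁ (fun s t => D.nprod u (-s - 1) (D.nprod v (-t - 1) w)) a b c
      - delta₂ (fun s t => D.nprod v (-t - 1) (D.nprod u (-s - 1) w)) a b c
    = delta₃ (fun r t => D.nprod (D.nprod u (-r - 1) v) (-t - 1) w) a b c

/-- `f` preserves the vacuum vector and the vertex operators: `f(Y(u, x) v) = Y(f(u), x) f(v)`. -/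
structure IsVertexAlgebraHom {V V' : Type*} [AddCommGroup V] [Module ℂ V] [AddCommGroup V']
    [Module ℂ V'] (D : VertexData V) (D' : VertexData V') (f : V →ₗ[ℂ] V') : Prop where
  map_one : f D.one = D'.one
  map_nprod : ∀ u n v, f (D.nprod u n v) = D'.nprod (f u) n (f v)

/-- A `Γ`-vertex algebra structure on the complex vector space `V`. -/
structure GammaVertexAlgebra (Γ V : Type*) [Group Γ] [AddCommGroup V] [Module ℂ V]
    extends VertexData V where
  isVertexAlgebra : toVertexData.IsVertexAlgebra
  R : Γ →* (V ≃ₗ[ℂ] V)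
  φ : Γ →* ℂˣ
  R_one : ∀ g, R g one = one
  /-- `R_g Y(v, x) R_g⁻¹ = Y(R_g v, φ(g)⁻¹ x)`, on `w`, at `x ^ (-n-1)`. -/
  R_conj : ∀ g v n w,
    R g (nprod v n ((R g).symm w)) = ((φ g : ℂ)⁻¹ ^ (-n - 1)) • nprod (R g v) n w

/-! ## The space `ℰ(W) = Hom(W, W((x)))`

It is `VertexOperator ℂ W`; the coefficient of `x ^ m` in `a(x)` is `HVertexOperator.coeff a m`. -/

variable {W : Type*} [AddCommGroup W] [Module ℂ W]

/-- The identity operator `1_W`, as a constant series. -/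
def idOp (W : Type*) [AddCommGroup W] [Module ℂ W] : VertexOperator ℂ W :=
  VertexOperator.of_coeff (fun m => if m = 0 then LinearMap.id else 0) (fun w => by
    refine ⟨0, fun m hm => ?_⟩
    by_contra h
    exact hm (by simp [show m ≠ 0 by lia]))

/-- `R_α a(x) = a(α x)`. -/
def rescale (α : ℂˣ) (a : VertexOperator ℂ W) : VertexOperator ℂ W :=
  HVertexOperator.of_coeff (fun m => ((α : ℂ) ^ m) • HVertexOperator.coeff a m) (fun w =>
    (HVertexOperator.coeff_isPWOsupport a w).mono (fun m hm h => hm (by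
      have h' : HVertexOperator.coeff a m w = 0 := h
      simp only [LinearMap.smul_apply, h', smul_zero])))

/-- `a(x₁) b(x₂) w`. -/
def mulSeries (a b : VertexOperator ℂ W) (w : W) : ℤ → ℤ → W :=
  fun s t => HVertexOperator.coeff a s (HVertexOperator.coeff b t w)

/-- `b(x₂) a(x₁) w`. -/
def mulSeriesRev (a b : VertexOperator ℂ W) (w : W) : ℤ → ℤ → W :=
  fun s t => HVertexOperator.coeff b t (HVertexOperator.coeff a s w)

/-- `p(x₁, x₂) a(x₁) b(x₂) = p(x₁, x₂) b(x₂) a(x₁)`. -/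
def LocalWith (p : MvPolynomial (Fin 2) ℂ) (a b : VertexOperator ℂ W) : Prop :=
  ∀ w, polyMul p (mulSeries a b w) = polyMul p (mulSeriesRev a b w)

/-- The pair `a(x), b(x)` is quasi-local. -/
def QuasiLocalPair (a b : VertexOperator ℂ W) : Prop :=
  ∃ p : MvPolynomial (Fin 2) ℂ, p ≠ 0 ∧ LocalWith p a b

/-- `(x₁ - α₁ x₂) ⋯ (x₁ - αᵣ x₂)`. -/
def linearProd (l : List ℂˣ) : MvPolynomial (Fin 2) ℂ :=
  (l.map fun α => MvPolynomial.X 0 - MvPolynomial.C (α : ℂ) * MvPolynomial.X 1).prod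

/-- The pair `a(x), b(x)` is `G`-local, for a subgroup `G` of `ℂˣ`. -/
def GammaLocalPair (G : Subgroup ℂˣ) (a b : VertexOperator ℂ W) : Prop :=
  ∃ l : List ℂˣ, (∀ α ∈ l, α ∈ G) ∧ LocalWith (linearProd l) a b

/-- Quasi-local subsets of `ℰ(W)`. -/
def IsQuasiLocal (S : Set (VertexOperator ℂ W)) : Prop :=
  ∀ a ∈ S, ∀ b ∈ S, QuasiLocalPair a b

/-- `G`-local subsets of `ℰ(W)`. -/
def IsGammaLocal (G : Subgroup ℂˣ) (S : Set (VertexOperator ℂ W)) : Prop :=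
  ∀ a ∈ S, ∀ b ∈ S, GammaLocalPair G a b

/-! ## The operation `Y_ℰ` -/

/-- `G(x₁, x₂) ∈ W((x₁, x₂))`. -/
def IsLaurent₂ (G : ℤ → ℤ → W) : Prop :=
  ∃ N : ℤ, ∀ s t, s < N ∨ t < N → G s t = 0

lemma exists_coeff_eq_zero (a : VertexOperator ℂ W) (w : W) :
    ∃ N : ℤ, ∀ m < N, HVertexOperator.coeff a m w = 0 :=
  ⟨_, fun m hm => VertexOperator.coeff_eq_zero_of_lt_order a m w hm⟩

/-- Quasi-locality puts `p(x₁, x₂) a(x₁) b(x₂) w` in `W((x₁, x₂))`. -/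
lemma LocalWith.isLaurent₂ {p : MvPolynomial (Fin 2) ℂ} {a b : VertexOperator ℂ W}
    (h : LocalWith p a b) (w : W) : IsLaurent₂ (polyMul p (mulSeries a b w)) := by
  obtain ⟨N, hN⟩ := exists_coeff_eq_zero a w
  obtain ⟨N', hN'⟩ := exists_coeff_eq_zero b w
  refine ⟨min N N', fun s t hst => ?_⟩
  rcases hst with hs | ht
  · rw [h w]
    refine Finset.sum_eq_zero fun d _ => ?_
    simp only [mulSeriesRev]
    rw [hN _ (by lia), map_zero, smul_zero]
  · refine Finset.sum_eq_zero fun d _ => ?_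
    simp only [mulSeries]
    rw [hN' _ (by lia), map_zero, smul_zero]

/-- The coefficient of `x ^ m x₀ ^ k` in `G(x + x₀, x)`, where powers of `x + x₀` are expanded in
nonnegative powers of `x₀`. -/
def substCoeff (G : ℤ → ℤ → W) (k : ℕ) (m : ℤ) : W :=
  ∑ᶠ s : ℤ, (Ring.choose s k : ℤ) • G s (m + k - s)

lemma IsLaurent₂.finite_support {G : ℤ → ℤ → W} (hG : IsLaurent₂ G) (k : ℕ) (m : ℤ) :
    (Function.support fun s : ℤ => (Ring.choose s k : ℤ) • G s (m + k - s)).Finite := by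
  obtain ⟨N, hN⟩ := hG
  refine (Set.finite_Icc N (m + k - N)).subset fun s hs => ?_
  by_contra h
  refine hs ?_
  simp only [Set.mem_Icc, not_and_or, not_le] at h
  simp only [hN s (m + k - s) (by lia), smul_zero]

/-- `W((x))`, a vector space over the field `ℂ((x))`. -/
def LaurentMod (W : Type*) [AddCommGroup W] [Module ℂ W] : Type _ := HahnModule ℤ ℂ W

instance : AddCommGroup (LaurentMod W) := inferInstanceAs (AddCommGroup (HahnModule ℤ ℂ W))

instance : Module (LaurentSeries ℂ) (LaurentMod W) :=
  inferInstanceAs (Module (HahnSeries ℤ ℂ) (HahnModule ℤ ℂ W))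

/-- `W((x))((x₀))`, a vector space over the field `ℂ((x))((x₀))`. -/
def IterLaurent (W : Type*) [AddCommGroup W] [Module ℂ W] : Type _ :=
  HahnModule ℤ (LaurentSeries ℂ) (LaurentMod W)

instance : AddCommGroup (IterLaurent W) :=
  inferInstanceAs (AddCommGroup (HahnModule ℤ (LaurentSeries ℂ) (LaurentMod W)))

instance : Module (LaurentSeries (LaurentSeries ℂ)) (IterLaurent W) :=
  inferInstanceAs (Module (HahnSeries ℤ (LaurentSeries ℂ))
    (HahnModule ℤ (LaurentSeries ℂ) (LaurentMod W)))

/-- The coefficient of `x₀ ^ k` in an element of `W((x))((x₀))`. -/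
def IterLaurent.coeff₀ (F : IterLaurent W) (k : ℤ) : HahnModule ℤ ℂ W :=
  ((HahnModule.of (LaurentSeries ℂ)).symm F : HahnSeries ℤ (LaurentMod W)).coeff k

/-- The coefficient of `x ^ m x₀ ^ k` in an element of `W((x))((x₀))`. -/
def IterLaurent.coeff (F : IterLaurent W) (k m : ℤ) : W :=
  ((HahnModule.of ℂ).symm (F.coeff₀ k)).coeff m

/-- The element of `W((x))((x₀))` with coefficients `f k m` at `x ^ m x₀ ^ k`, for `k ≥ 0`. -/
def IterLaurent.ofCoeff (f : ℕ → ℤ → W) (hf : ∀ k, BddBelow (Function.support (f k))) :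
    IterLaurent W :=
  HahnModule.of (LaurentSeries ℂ) <| HahnSeries.ofSuppBddBelow
    (fun k : ℤ => if 0 ≤ k then
      (HahnModule.of ℂ (HahnSeries.ofSuppBddBelow (f k.toNat) (hf _)) : LaurentMod W) else 0)
    ⟨0, fun k hk => by
      by_contra h
      exact hk (if_neg h)⟩

lemma IsLaurent₂.bddBelow {G : ℤ → ℤ → W} (hG : IsLaurent₂ G) (k : ℕ) :
    BddBelow (Function.support (substCoeff G k)) := by
  obtain ⟨N, hN⟩ := hG
  refine ⟨2 * N - k, fun m hm => ?_⟩
  by_contra h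
  refine hm (finsum_eq_zero_of_forall_eq_zero fun s => ?_)
  rw [hN s _ (by lia), smul_zero]

/-- The substitution `G(x₁, x)|_{x₁ = x + x₀}`, from `W((x₁, x))` to `W((x))[[x₀]]`. -/
def subst (G : ℤ → ℤ → W) (hG : IsLaurent₂ G) : IterLaurent W :=
  IterLaurent.ofCoeff (substCoeff G) hG.bddBelow

/-- The element `x` of `ℂ((x))((x₀))`. -/
def varX : LaurentSeries (LaurentSeries ℂ) := HahnSeries.C (HahnSeries.single 1 1)

/-- The element `x₀` of `ℂ((x))((x₀))`. -/
def varX₀ : LaurentSeries (LaurentSeries ℂ) := HahnSeries.single 1 1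

/-- `p(x + x₀, x)`, in the field `ℂ((x))((x₀))`; its inverse there is `ι_{x,x₀}(1/p(x + x₀, x))`. -/
def polyShift (p : MvPolynomial (Fin 2) ℂ) : LaurentSeries (LaurentSeries ℂ) :=
  MvPolynomial.aeval ![varX + varX₀, varX] p

/-- `ι_{x,x₀}(1/p(x + x₀, x)) (p(x₁, x) a(x₁) b(x) w)|_{x₁ = x + x₀}`. -/
def YEseries (p : MvPolynomial (Fin 2) ℂ) (a b : VertexOperator ℂ W) (h : LocalWith p a b)
    (w : W) : IterLaurent W :=
  (polyShift p)⁻¹ • subst (polyMul p (mulSeries a b w)) (h.isLaurent₂ w)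

lemma IterLaurent.ext {F F' : IterLaurent W} (h : ∀ k m, F.coeff k m = F'.coeff k m) : F = F' := by
  apply HahnModule.ext
  funext k
  apply HahnModule.ext
  funext m
  exact h k m

lemma subst_coeff (G : ℤ → ℤ → W) (hG : IsLaurent₂ G) (k m : ℤ) :
    (subst G hG).coeff k m = if 0 ≤ k then substCoeff G k.toNat m else 0 := by
  change ((HahnModule.of ℂ).symm (if 0 ≤ k then (HahnModule.of ℂ (HahnSeries.ofSuppBddBelow
    (substCoeff G k.toNat) (hG.bddBelow _)) : HahnModule ℤ ℂ W) else 0)).coeff m = _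
  split_ifs <;> rfl

lemma YEseries_add {p : MvPolynomial (Fin 2) ℂ} {a b : VertexOperator ℂ W} (h : LocalWith p a b)
    (w w' : W) : YEseries p a b h (w + w') = YEseries p a b h w + YEseries p a b h w' := by
  unfold YEseries
  rw [← smul_add]
  congr 1
  apply IterLaurent.ext
  intro k m
  have hadd : ∀ F F' : IterLaurent W, (F + F').coeff k m = F.coeff k m + F'.coeff k m :=
    fun _ _ => rfl
  rw [hadd, subst_coeff, subst_coeff, subst_coeff]
  split_ifs
  · unfold substCoeff
    rw [← finsum_add_distrib ((h.isLaurent₂ w).finite_support _ _)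
      ((h.isLaurent₂ w').finite_support _ _)]
    refine finsum_congr fun s => ?_
    simp [polyMul, mulSeries, Finset.sum_add_distrib]
  · simp

lemma coeff_single_smul (r : ℂ) (F : IterLaurent W) (k m : ℤ) :
    IterLaurent.coeff ((HahnSeries.single 0 (HahnSeries.single 0 r : LaurentSeries ℂ) :
      LaurentSeries (LaurentSeries ℂ)) • F) k m = r • F.coeff k m := by
  have h₁ : ∀ y : LaurentMod W, ((HahnModule.of ℂ).symm ((HahnSeries.single 0 r : LaurentSeries ℂ) •
      y : HahnModule ℤ ℂ W)).coeff m =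
      r • ((HahnModule.of ℂ).symm (y : HahnModule ℤ ℂ W)).coeff m :=
    fun y => HahnModule.coeff_single_zero_smul (Γ := ℤ) (Γ' := ℤ)
  refine Eq.trans ?_ (h₁ (F.coeff₀ k))
  exact congrArg (fun y : LaurentMod W => ((HahnModule.of ℂ).symm (y : HahnModule ℤ ℂ W)).coeff m)
    (HahnModule.coeff_single_zero_smul (Γ := ℤ) (Γ' := ℤ) (R := LaurentSeries ℂ)
      (V := LaurentMod W))

lemma YEseries_smul {p : MvPolynomial (Fin 2) ℂ} {a b : VertexOperator ℂ W} (h : LocalWith p a b)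
    (r : ℂ) (w : W) (k m : ℤ) :
    (YEseries p a b h (r • w)).coeff k m = r • (YEseries p a b h w).coeff k m := by
  have key : YEseries p a b h (r • w) =
      (HahnSeries.single 0 (HahnSeries.single 0 r : LaurentSeries ℂ) :
        LaurentSeries (LaurentSeries ℂ)) • YEseries p a b h w := by
    unfold YEseries
    refine Eq.trans ?_ (((smul_smul _ _ _).trans
      (congrArg (· • subst _ (h.isLaurent₂ w)) (mul_comm (polyShift p)⁻¹ _))).trans
      (smul_smul _ _ _).symm)
    congr 1
    apply IterLaurent.ext
    intro k m
    rw [coeff_single_smul, subst_coeff, subst_coeff]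
    split_ifs
    · unfold substCoeff
      rw [smul_finsum' r ((h.isLaurent₂ w).finite_support _ _)]
      refine finsum_congr fun s => ?_
      simp only [polyMul, mulSeries, map_smul, Finset.smul_sum]
      refine Finset.sum_congr rfl fun d _ => ?_
      rw [smul_comm r, smul_comm (_ : ℂ) r]
    · simp
  rw [key, coeff_single_smul]

/-- The operator `a(x)_n b(x)` computed with `p`: the coefficient of `x₀ ^ (-n-1)`. -/
def YEwith (p : MvPolynomial (Fin 2) ℂ) (a b : VertexOperator ℂ W) (h : LocalWith p a b)
    (n : ℤ) : VertexOperator ℂ W where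
  toFun w := (YEseries p a b h w).coeff₀ (-n - 1)
  map_add' w w' := by
    rw [YEseries_add]
    rfl
  map_smul' r w := by
    apply HahnModule.ext
    funext m
    exact YEseries_smul h r w (-n - 1) m

open Classical in
/-- `a(x)_n b(x)`, where `Y_ℰ(a(x), x₀) b(x) = ∑ₙ a(x)_n b(x) x₀ ^ (-n-1)`, for a quasi-local pair;
any nonzero polynomial that makes the pair local computes it. -/
def YE (a : VertexOperator ℂ W) (n : ℤ) (b : VertexOperator ℂ W) : VertexOperator ℂ W :=
  if h : QuasiLocalPair a b then YEwith h.choose a b h.choose_spec.2 n else 0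

/-- A closed (quasi-local) subspace of `ℰ(W)`. -/
structure IsClosedSubspace (U : Submodule ℂ (VertexOperator ℂ W)) : Prop where
  quasiLocal : IsQuasiLocal (U : Set (VertexOperator ℂ W))
  closed : ∀ a ∈ U, ∀ b ∈ U, ∀ n, YE a n b ∈ U

/-- `(U, 1_W, Y_ℰ)`, for a closed subspace `U` that contains `1_W`. -/
def subspaceData (U : Submodule ℂ (VertexOperator ℂ W)) (h1 : idOp W ∈ U)
    (hU : IsClosedSubspace U) : VertexData U where
  one := ⟨idOp W, h1⟩
  nprod a n b := ⟨YE a n b, hU.closed a a.2 b b.2 n⟩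

/-! ## Quasimodules -/

/-- `(W, Y_W)` is a quasimodule for the vertex algebra `V`. -/
structure IsQuasimodule {V : Type*} [AddCommGroup V] [Module ℂ V] (D : VertexData V)
    (YW : V →ₗ[ℂ] VertexOperator ℂ W) : Prop where
  vacuum : YW D.one = idOp W
  quasiJacobi : ∀ u v, ∃ p : MvPolynomial (Fin 2) ℂ, p ≠ 0 ∧ ∀ w a b c,
    delta₁ (polyMul p (mulSeries (YW u) (YW v) w)) a b c
      - delta₂ (polyMul p (mulSeriesRev (YW u) (YW v) w)) a b c
    = polyMul p
        (delta₃ (fun r t => HVertexOperator.coeff (YW (D.nprod u (-r - 1) v)) t w) a) b c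

/-- `(W, Y_W)` is a quasimodule for the `Γ`-vertex algebra `V`. -/
structure GammaVertexAlgebra.IsQuasimodule {Γ V : Type*} [Group Γ] [AddCommGroup V] [Module ℂ V]
    (D : GammaVertexAlgebra Γ V) (YW : V →ₗ[ℂ] VertexOperator ℂ W) : Prop where
  isQuasimodule : VAlg.IsQuasimodule D.toVertexData YW
  equivariant : ∀ g v, YW (D.R g v) = rescale (D.φ g) (YW v)
  gammaLocal : ∀ u v, GammaLocalPair D.φ.range (YW u) (YW v)

end VAlg

end

/-! Given locality, both directions say that the Jacobi identity multiplied by a polynomial is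
equivalent to the equation defining `YE`. If `p` makes `a, b` local, then `G = p a(x₁) b(x₂) w = p
b(x₂) a(x₁) w` lies in `W((x₁, x₂))`. The delta function identity `delta₁_sub_delta₂` turns the left
side of Jacobi into `x₂⁻¹ δ((x₁ - x₀) / x₂) G(x₂ + x₀, x₂)`. By definition of `Y_ℰ`, `G(x₂ + x₀, x₂)
= p(x₂ + x₀, x₂) Y_ℰ(a, x₀) b w`, and next to the delta function `p(x₂ + x₀, x₂)` may be replaced by
`p(x₁, x₂)` (`delta₃_polyShift_smul`). This is Jacobi for `Y_ℰ` (`QuasiLocalPair.jacobi`).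

Conversely, the coefficient of `x₁⁻¹` in a Jacobi identity recovers `p(x₂ + x₀, x₂) C = G(x₂ + x₀,
x₂)` for the series `C` on its right side. Since `ℂ((x))((x₀))` is a field and `p(x + x₀, x) ≠ 0`
(`polyShift_ne_zero`), this forces `C = Y_ℰ(a, x₀) b w` (`QuasiLocalPair.YE_eq_of_jacobi`).

The vertex algebra axioms on the image then need no separate theory of closed subspaces: they
transfer along the surjection from `V`. -/

noncomputable section

namespace VAlg

/-! ### Binomial identities behind the delta function calculus -/

section Binomial

lemma choose_neg_int (r : ℤ) (k : ℕ) :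
    Ring.choose (-r) k = (-1) ^ k * Ring.choose (r + k - 1) k := by
  rw [Ring.choose_neg, Units.smul_def, smul_eq_mul, Int.coe_negOnePow_natCast]

lemma choose_natCast_eq_zero {n k : ℕ} (h : n < k) : Ring.choose (n : ℤ) k = 0 := by
  rw [Ring.choose_natCast, Nat.choose_eq_zero_of_lt h, Nat.cast_zero]

lemma choose_natCast_symm (i j : ℕ) :
    Ring.choose ((i + j : ℕ) : ℤ) i = Ring.choose ((i + j : ℕ) : ℤ) j := by
  rw [Ring.choose_natCast, Ring.choose_natCast, Nat.choose_symm_add]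

/-- The coefficients of the two expansions of `(x₁ - x₂) ^ n` differ by those of a derivative of
the delta function. -/
lemma expansion_coeff_sub (n d : ℤ) :
    ((if 0 ≤ d + n then (-1) ^ (d + n).toNat * Ring.choose n (d + n).toNat else 0) -
      if d ≤ 0 then (Int.negOnePow n : ℤ) * (-1) ^ (-d).toNat * Ring.choose n (-d).toNat else 0) =
    if n < 0 then Ring.choose (d - 1) (-n - 1).toNat else 0 := by
  rcases lt_or_ge n 0 with hn | hn
  · obtain ⟨a, rfl⟩ : ∃ a : ℕ, n = -(a + 1 : ℤ) := ⟨(-n - 1).toNat, by lia⟩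
    rw [if_pos hn, show (-(-(a + 1 : ℤ)) - 1).toNat = a by lia]
    -- Here `-d` is the exponent of `x₁`. For `n < 0` the ranges `d + n ≥ 0` and `d ≤ 0` are
    -- disjoint, so at most one expansion contributes.
    rcases lt_or_ge 0 d with hd | hd
    · rw [if_neg (by lia : ¬ d ≤ 0), sub_zero]
      split_ifs with h
      · obtain ⟨j, rfl⟩ : ∃ j : ℕ, d = j + a + 1 := ⟨(d - a - 1).toNat, by lia⟩
        rw [show ((j + a + 1 : ℤ) + -(a + 1 : ℤ)).toNat = j by lia, choose_neg_int, ← mul_assoc,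
          ← mul_pow, neg_one_mul, neg_neg, one_pow, one_mul,
          show (a : ℤ) + 1 + j - 1 = ((j + a : ℕ) : ℤ) by push_cast; ring,
          show (j : ℤ) + a + 1 - 1 = ((j + a : ℕ) : ℤ) by push_cast; ring, choose_natCast_symm]
      · obtain ⟨j, rfl⟩ : ∃ j : ℕ, d = j + 1 := ⟨(d - 1).toNat, by lia⟩
        rw [show (j : ℤ) + 1 - 1 = j by ring, choose_natCast_eq_zero (by lia)]
    · obtain ⟨j, rfl⟩ : ∃ j : ℕ, d = -(j : ℤ) := ⟨(-d).toNat, by lia⟩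
      rw [if_neg (by lia), if_pos hd, zero_sub, neg_neg, Int.toNat_natCast, choose_neg_int,
        show -(j : ℤ) - 1 = -(j + 1 : ℤ) by ring, choose_neg_int, Int.negOnePow_neg,
        show ((a : ℤ) + 1) = ((a + 1 : ℕ) : ℤ) by simp, Int.coe_negOnePow_natCast,
        show ((a + 1 : ℕ) : ℤ) + j - 1 = ((j + a : ℕ) : ℤ) by push_cast; ring,
        show (j : ℤ) + 1 + a - 1 = ((j + a : ℕ) : ℤ) by push_cast; ring, choose_natCast_symm,
        pow_succ]
      have : ((-1) ^ j * (-1) ^ j : ℤ) = 1 := by rw [← mul_pow]; simp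
      linear_combination ((-1) ^ a * Ring.choose ((j + a : ℕ) : ℤ) a) * this
  -- For `n ≥ 0` both expansions are the same polynomial.
  · rw [if_neg (by lia : ¬ n < 0)]
    obtain ⟨n, rfl⟩ := Int.eq_ofNat_of_zero_le hn
    rcases lt_or_ge 0 d with hd | hd
    · rw [if_neg (by lia : ¬ d ≤ 0), if_pos (by lia), choose_natCast_eq_zero (by lia)]
      simp
    · obtain ⟨j, rfl⟩ : ∃ j : ℕ, d = -(j : ℤ) := ⟨(-d).toNat, by lia⟩
      rw [if_pos hd, neg_neg, Int.toNat_natCast]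
      split_ifs with h
      · obtain ⟨i, rfl⟩ : ∃ i : ℕ, n = i + j := ⟨n - j, by lia⟩
        rw [show (-(j : ℤ) + (i + j : ℕ)).toNat = i by lia, choose_natCast_symm,
          Int.coe_negOnePow_natCast, pow_add, mul_assoc ((-1) ^ i : ℤ), ← mul_pow]
        simp
      · rw [choose_natCast_eq_zero (by lia : n < j)]
        simp

/-- Chu–Vandermonde for `-(b + 1) + s`, since `(-1) ^ i * choose (b + i) i = choose (-(b + 1)) i`.
-/
lemma sum_choose_mul_choose (s b : ℤ) (a : ℕ) :
    ∑ i ∈ Finset.range (a + 1),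
      (-1) ^ i * Ring.choose (b + i) i * Ring.choose s (a - i) = Ring.choose (s - b - 1) a := by
  rw [show s - b - 1 = -(b + 1) + s by ring, Ring.add_choose_eq _ (Commute.all _ _),
    Finset.Nat.sum_antidiagonal_eq_sum_range_succ_mk]
  refine Finset.sum_congr rfl fun i _ => ?_
  rw [choose_neg_int, show b + 1 + (i : ℤ) - 1 = b + i by ring]

end Binomial

/-! ### The three-term delta function identity -/

section Deltas

variable {M : Type*} [AddCommGroup M]

/-- Together with `finsum_nat_eq_finsum_sub`, this lets expansions in opposite directions be
compared term by term over one index set `ℤ`. -/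
lemma finsum_nat_eq_finsum_add (g : ℕ → M) (s₀ : ℤ) :
    ∑ᶠ i, g i = ∑ᶠ s : ℤ, if s₀ ≤ s then g (s - s₀).toNat else 0 := by
  have hinj : Function.Injective fun i : ℕ => s₀ + (i : ℤ) := fun i j h => by
    simpa using h
  have h := finsum_mem_range (f := fun s : ℤ => if s₀ ≤ s then g (s - s₀).toNat else 0) hinj
  refine Eq.trans ?_ (h.symm.trans ?_)
  · exact finsum_congr fun i => by simp
  · refine finsum_congr fun s => ?_
    by_cases hs : s₀ ≤ s
    · have hmem : s ∈ Set.range fun i : ℕ => s₀ + (i : ℤ) := ⟨(s - s₀).toNat, by simp; lia⟩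
      simp only [hmem, finsum_true]
    · simp [hs]

lemma finsum_nat_eq_finsum_sub (g : ℕ → M) (s₀ : ℤ) :
    ∑ᶠ i, g i = ∑ᶠ s : ℤ, if s ≤ s₀ then g (s₀ - s).toNat else 0 := by
  rw [finsum_nat_eq_finsum_add g (-s₀), ← finsum_comp_equiv (Equiv.neg ℤ)]
  refine finsum_congr fun s => ?_
  simp only [Equiv.neg_apply, neg_le_neg_iff, neg_sub_neg]

variable [Module ℂ M]

/-- `x₀⁻¹ δ((x₁ - x₂) / x₀) G(x₁, x₂) - x₀⁻¹ δ((x₂ - x₁) / (-x₀)) G(x₁, x₂)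
  = x₂⁻¹ δ((x₁ - x₀) / x₂) G(x₂ + x₀, x₂)` for `G(x₁, x₂) ∈ W((x₁, x₂))`. -/
lemma delta₁_sub_delta₂ (G : ℤ → ℤ → M) (hG : IsLaurent₂ G) (a b c : ℤ) :
    delta₁ G a b c - delta₂ G a b c = delta₃ (fun k m => (subst G hG).coeff k m) a b c := by
  set n := -a - 1 with hn
  -- At `x₀ ^ a x₁ ^ b x₂ ^ c` all three terms see `G` only in total degree `b + c - n`. There `G`
  -- has finitely many nonzero coefficients, indexed by the exponent `s` of `x₁`.
  set f : ℤ → M := fun s => G s (b + c - n - s) with hf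
  have hfin : f.support.Finite := by
    obtain ⟨N, hN⟩ := hG
    refine (Set.finite_Icc N (b + c - n - N)).subset fun s hs => ?_
    by_contra h
    simp only [Set.mem_Icc, not_and_or, not_le] at h
    exact hs (hN _ _ (by lia))
  have hfin' (g : ℤ → ℤ) : (Function.support fun s => g s • f s).Finite :=
    hfin.subset fun s hs h => hs (by simp [h])
  have h₁ : delta₁ G a b c = ∑ᶠ s, (if 0 ≤ (s - b) + n then
      (-1) ^ ((s - b) + n).toNat * Ring.choose n ((s - b) + n).toNat else 0) • f s := by
    rw [delta₁, finsum_nat_eq_finsum_add _ (b - n)]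
    refine finsum_congr fun s => ?_
    by_cases h : b - n ≤ s
    · obtain ⟨i, rfl⟩ : ∃ i : ℕ, s = b - n + i := ⟨(s - (b - n)).toNat, by lia⟩
      rw [if_pos h, if_pos (by lia), show (b - n + i - (b - n)).toNat = i by lia,
        show (b - n + i - b + n).toNat = i by lia]
      simp only [hf, ← hn]
      congr 2
      ring
    · rw [if_neg h, if_neg (by lia), zero_smul]
  have h₂ : delta₂ G a b c = ∑ᶠ s, (if s - b ≤ 0 then
      (Int.negOnePow n : ℤ) * (-1) ^ (-(s - b)).toNat * Ring.choose n (-(s - b)).toNat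
        else 0) • f s := by
    rw [delta₂, finsum_nat_eq_finsum_sub _ b]
    refine finsum_congr fun s => ?_
    by_cases h : s ≤ b
    · obtain ⟨i, rfl⟩ : ∃ i : ℕ, s = b - i := ⟨(b - s).toNat, by lia⟩
      rw [if_pos h, if_pos (by lia), show (b - (b - (i : ℤ))).toNat = i by lia,
        show (-(b - (i : ℤ) - b)).toNat = i by lia]
      simp only [hf, ← hn]
      congr 2
      ring
    · rw [if_neg h, if_neg (by lia), zero_smul]
  have h₃ : delta₃ (fun k m => (subst G hG).coeff k m) a b c =
      ∑ᶠ s, (if n < 0 then Ring.choose ((s - b) - 1) (-n - 1).toNat else 0) • f s := by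
    simp only [delta₃, subst_coeff]
    by_cases ha : n < 0
    · obtain ⟨k, hk⟩ : ∃ k : ℕ, a = k := ⟨a.toNat, by lia⟩
      rw [finsum_eq_sum_of_support_subset (s := Finset.range (k + 1))]
      · have : ∀ i ∈ Finset.range (k + 1), (((-1) ^ i * Ring.choose (b + i) i : ℤ) •
            if 0 ≤ a - i then substCoeff G (a - i).toNat (c + (b + i) + 1) else 0) =
            ∑ᶠ s, ((-1) ^ i * Ring.choose (b + i) i * Ring.choose s (k - i) : ℤ) • f s := by
          intro i hi
          have hi' : i ≤ k := by simpa [Nat.lt_succ_iff] using hi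
          rw [if_pos (by lia), substCoeff, smul_finsum' _ (hG.finite_support _ _)]
          refine finsum_congr fun s => ?_
          rw [smul_smul, show (a - i).toNat = k - i by lia]
          simp only [hf]
          congr 2
          push_cast [hi']
          lia
        rw [Finset.sum_congr rfl this, sum_finsum_comm _ _ fun i _ => hfin' _]
        refine finsum_congr fun s => ?_
        rw [if_pos ha, ← Finset.sum_smul, sum_choose_mul_choose,
          show (-n - 1).toNat = k by lia]
      · intro i hi
        simp only [Finset.coe_range, Set.mem_Iio]
        by_contra h
        exact hi (by simp only; rw [if_neg (by lia), smul_zero])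
    -- Here `a < 0`, and the substitution has only nonnegative powers of `x₀`.
    · rw [finsum_eq_zero_of_forall_eq_zero, finsum_eq_zero_of_forall_eq_zero]
      · intro s
        rw [if_neg ha, zero_smul]
      · intro i
        rw [if_neg (by lia), smul_zero]
  rw [h₁, h₂, h₃, ← finsum_sub_distrib (hfin' _) (hfin' _)]
  refine finsum_congr fun s => ?_
  rw [← sub_smul, expansion_coeff_sub]

end Deltas

/-! ### `delta₃` on series truncated below in `x₀` -/

section Truncated

variable {M : Type*} [AddCommGroup M]

lemma finite_support_of_le {f : ℕ → M} (K : ℤ) (h : ∀ i : ℕ, K ≤ i → f i = 0) :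
    (Function.support f).Finite := by
  refine (Set.finite_Iio K.toNat).subset fun i hi => ?_
  by_contra hK
  exact hi (h i (by simp at hK; lia))

lemma map_finsum_of_le {N : Type*} [AddCommGroup N] (φ : M →+ N) {f : ℕ → M} (K : ℤ)
    (h : ∀ i : ℕ, K ≤ i → f i = 0) : φ (∑ᶠ i, f i) = ∑ᶠ i, φ (f i) :=
  φ.map_finsum (finite_support_of_le K h)

/-- At `x₁⁻¹` the coefficients are `choose (i - 1) i`, which vanish for `i > 0`. Hence `C` can be
read off from `delta₃ C`, which is how identities of delta series yield identities in
`W((x))((x₀))`. -/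
lemma delta₃_neg_one (C : ℤ → ℤ → M) (a c : ℤ) : delta₃ C a (-1) c = C a c := by
  rw [delta₃, finsum_eq_single _ 0]
  · simp
  · intro i hi
    obtain ⟨j, rfl⟩ := Nat.exists_eq_succ_of_ne_zero hi
    rw [show (-1 : ℤ) + (j.succ : ℕ) = (j : ℤ) by push_cast; ring,
      choose_natCast_eq_zero (Nat.lt_succ_self j)]
    simp

lemma finite_support_delta₃ {C : ℤ → ℤ → M} {N : ℤ} (hC : ∀ k m, k < N → C k m = 0)
    (z : ℕ → ℤ) (g : ℕ → ℤ) (a : ℤ) :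
    (Function.support fun i : ℕ => z i • C (a - i) (g i)).Finite :=
  finite_support_of_le (a - N + 1) fun i hi => by rw [hC _ _ (by lia), smul_zero]

lemma delta₃_add {C C' : ℤ → ℤ → M} {N N' : ℤ} (hC : ∀ k m, k < N → C k m = 0)
    (hC' : ∀ k m, k < N' → C' k m = 0) (a b c : ℤ) :
    delta₃ (C + C') a b c = delta₃ C a b c + delta₃ C' a b c := by
  simp only [delta₃, Pi.add_apply, smul_add]
  exact finsum_add_distrib (finite_support_delta₃ hC _ _ _) (finite_support_delta₃ hC' _ _ _)

/-- `x₁ x₂⁻¹ δ((x₁ - x₀) / x₂) = (x₂ + x₀) x₂⁻¹ δ((x₁ - x₀) / x₂)`. -/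
lemma delta₃_shift {C : ℤ → ℤ → M} {N : ℤ} (hC : ∀ k m, k < N → C k m = 0) (a b c : ℤ) :
    delta₃ (fun k m => C k (m - 1) + C (k - 1) m) a b c = delta₃ C a (b - 1) c := by
  set z : ℕ → ℤ := fun i => (-1) ^ i * Ring.choose (b + i) i with hz
  set z' : ℕ → ℤ := fun i => (-1) ^ i * Ring.choose (b - 1 + i) i with hz'
  set f : ℕ → M := fun i => C (a - i) (c + b + i) with hf
  have hfin (y : ℕ → ℤ) : (Function.support fun i => y i • f i).Finite :=
    finite_support_delta₃ hC _ _ _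
  have hfin' : (Function.support fun i => z i • f (i + 1)).Finite :=
    finite_support_of_le (a - N + 1) fun i hi => by
      simp only [hf]; rw [hC _ _ (by push_cast; lia), smul_zero]
  have h₁ : delta₃ (fun k m => C k (m - 1) + C (k - 1) m) a b c =
      ∑ᶠ i, z i • f i + ∑ᶠ i, z i • f (i + 1) := by
    rw [← finsum_add_distrib (hfin _) hfin']
    refine finsum_congr fun i => ?_
    simp only [hf, ← smul_add]
    congr 3 <;> push_cast <;> ring
  have h₂ : delta₃ C a (b - 1) c = ∑ᶠ i, z' i • f i := by
    refine finsum_congr fun i => ?_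
    simp only [hf]
    congr 2
    ring
  -- Pascal's rule after shifting the index; the new term at `0` vanishes because `z 0 = z' 0 = 1`.
  have h₃ : ∑ᶠ i, z i • f (i + 1) = ∑ᶠ i, (z' i - z i) • f i := by
    obtain ⟨K, hK⟩ : ∃ K : ℕ, ∀ i, K ≤ i → f i = 0 :=
      ⟨(a - N + 1).toNat, fun i hi => hC _ _ (by lia)⟩
    rw [finsum_eq_sum_of_support_subset (s := Finset.range K),
      finsum_eq_sum_of_support_subset (s := Finset.range (K + 1)), Finset.sum_range_succ']
    · rw [show z' 0 - z 0 = 0 by simp [hz, hz'], zero_smul, add_zero]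
      refine Finset.sum_congr rfl fun i _ => ?_
      congr 1
      simp only [hz, hz']
      have := Ring.choose_succ_succ (b + i : ℤ) i
      rw [show b - 1 + ((i + 1 : ℕ) : ℤ) = b + i by push_cast; ring,
        show b + ((i + 1 : ℕ) : ℤ) = b + i + 1 by push_cast; ring, this]
      ring
    · intro i hi
      simp only [Finset.coe_range, Set.mem_Iio]
      by_contra h
      exact hi (by simp only; rw [hK _ (by lia), smul_zero])
    · intro i hi
      simp only [Finset.coe_range, Set.mem_Iio]
      by_contra h
      exact hi (by simp only; rw [hK _ (by lia), smul_zero])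
  rw [h₁, h₂, h₃, ← finsum_add_distrib (hfin _) (hfin _)]
  refine finsum_congr fun i => ?_
  rw [← add_smul, add_sub_cancel]

end Truncated

/-! ### Multiplication of formal series by polynomials -/

section PolyMul

variable {M : Type*} [AddCommGroup M] [Module ℂ M]

lemma polyMul_eq_sum {p : MvPolynomial (Fin 2) ℂ} {S : Finset (Fin 2 →₀ ℕ)} (h : p.support ⊆ S)
    (A : ℤ → ℤ → M) (s t : ℤ) :
    polyMul p A s t = ∑ d ∈ S, p.coeff d • A (s - d 0) (t - d 1) :=
  Finset.sum_subset h fun d _ hd => by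
    rw [MvPolynomial.notMem_support_iff.1 hd, zero_smul]

lemma add_polyMul (p q : MvPolynomial (Fin 2) ℂ) (A : ℤ → ℤ → M) :
    polyMul (p + q) A = polyMul p A + polyMul q A := by
  classical
  funext s t
  simp only [Pi.add_apply]
  rw [polyMul_eq_sum MvPolynomial.support_add, polyMul_eq_sum Finset.subset_union_left,
    polyMul_eq_sum Finset.subset_union_right, ← Finset.sum_add_distrib]
  simp only [MvPolynomial.coeff_add, add_smul]

lemma monomial_polyMul (d : Fin 2 →₀ ℕ) (r : ℂ) (A : ℤ → ℤ → M) (s t : ℤ) :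
    polyMul (MvPolynomial.monomial d r) A s t = r • A (s - d 0) (t - d 1) := by
  classical
  rw [polyMul_eq_sum MvPolynomial.support_monomial_subset, Finset.sum_singleton,
    MvPolynomial.coeff_monomial, if_pos rfl]

lemma polyMul_add (p : MvPolynomial (Fin 2) ℂ) (A B : ℤ → ℤ → M) :
    polyMul p (A + B) = polyMul p A + polyMul p B := by
  funext s t
  simp [polyMul, Finset.sum_add_distrib]

lemma polyMul_sub (p : MvPolynomial (Fin 2) ℂ) (A B : ℤ → ℤ → M) :
    polyMul p (A - B) = polyMul p A - polyMul p B := by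
  funext s t
  simp [polyMul, smul_sub]

lemma mul_polyMul (p q : MvPolynomial (Fin 2) ℂ) (A : ℤ → ℤ → M) :
    polyMul (p * q) A = polyMul p (polyMul q A) := by
  induction p using MvPolynomial.induction_on' with
  | monomial u a =>
    induction q using MvPolynomial.induction_on' with
    | monomial v b =>
      funext s t
      simp only [MvPolynomial.monomial_mul, monomial_polyMul, smul_smul, Finsupp.add_apply,
        Nat.cast_add, sub_sub]
    | add q q' hq hq' => rw [mul_add, add_polyMul, hq, hq', add_polyMul, polyMul_add]
  | add p p' hp hp' => rw [add_mul, add_polyMul, hp, hp', add_polyMul]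

lemma C_polyMul (r : ℂ) (A : ℤ → ℤ → M) : polyMul (MvPolynomial.C r) A = r • A := by
  funext s t
  rw [MvPolynomial.C_apply, monomial_polyMul]
  simp

lemma X_zero_polyMul (A : ℤ → ℤ → M) (s t : ℤ) :
    polyMul (MvPolynomial.X 0) A s t = A (s - 1) t := by
  rw [MvPolynomial.X, monomial_polyMul]
  simp

lemma X_one_polyMul (A : ℤ → ℤ → M) (s t : ℤ) :
    polyMul (MvPolynomial.X 1) A s t = A s (t - 1) := by
  rw [MvPolynomial.X, monomial_polyMul]
  simp

lemma IsLaurent₂.polyMul {A : ℤ → ℤ → M} (hA : IsLaurent₂ A) (p : MvPolynomial (Fin 2) ℂ) :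
    IsLaurent₂ (VAlg.polyMul p A) := by
  obtain ⟨N, hN⟩ := hA
  refine ⟨N, fun s t hst => Finset.sum_eq_zero fun d _ => ?_⟩
  rw [hN _ _ (by lia), smul_zero]

lemma finsum_zsmul_polyMul (z : ℕ → ℤ) (f g : ℕ → ℤ) (p : MvPolynomial (Fin 2) ℂ)
    (A : ℤ → ℤ → M)
    (h : ∀ x y : ℤ, (Function.support fun i => z i • A (f i - x) (g i - y)).Finite) :
    ∑ᶠ i, z i • polyMul p A (f i) (g i) =
      ∑ d ∈ p.support, p.coeff d • ∑ᶠ i, z i • A (f i - d 0) (g i - d 1) := by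
  simp only [polyMul, Finset.smul_sum]
  rw [finsum_sum_comm]
  · refine Finset.sum_congr rfl fun d _ => ?_
    rw [smul_finsum' _ (h _ _)]
    exact finsum_congr fun i => smul_comm _ _ _
  · refine fun d _ => (h (d 0) (d 1)).subset fun i hi hi' => hi ?_
    simp only at hi' ⊢
    rw [smul_comm, hi', smul_zero]

/-- The expansion lowers the exponent of `x₂` without bound, so truncation in `x₂` alone makes the
sums finite. Thus it applies to `a(x₁) b(x₂) w` without locality, as `delta₂_polyMul` does to `b(x₂)
a(x₁) w`. -/
lemma delta₁_polyMul (p : MvPolynomial (Fin 2) ℂ) {A : ℤ → ℤ → M} {N : ℤ}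
    (hA : ∀ s t, t < N → A s t = 0) (a b c : ℤ) :
    delta₁ (polyMul p A) a b c = polyMul p (delta₁ A a) b c := by
  simp only [delta₁]
  rw [finsum_zsmul_polyMul]
  · refine Finset.sum_congr rfl fun d _ => congrArg _ (finsum_congr fun i => ?_)
    congr 2 <;> ring
  · intro x y
    exact finite_support_of_le (c - y - N + 1) fun i hi => by rw [hA _ _ (by lia), smul_zero]

lemma delta₂_polyMul (p : MvPolynomial (Fin 2) ℂ) {A : ℤ → ℤ → M} {N : ℤ}
    (hA : ∀ s t, s < N → A s t = 0) (a b c : ℤ) :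
    delta₂ (polyMul p A) a b c = polyMul p (delta₂ A a) b c := by
  simp only [delta₂]
  rw [finsum_zsmul_polyMul]
  · refine Finset.sum_congr rfl fun d _ => congrArg _ (finsum_congr fun i => ?_)
    congr 2 <;> ring
  · intro x y
    exact finite_support_of_le (b - x - N + 1) fun i hi => by rw [hA _ _ (by lia), smul_zero]

end PolyMul

/-! ### The substitution `x₁ = x₂ + x₀` and multiplication by polynomials -/

section Shift

variable {W : Type*} [AddCommGroup W] [Module ℂ W]

lemma delta₃_smul {C : ℤ → ℤ → W} {N : ℤ} (hC : ∀ k m, k < N → C k m = 0) (r : ℂ) (a b c : ℤ) :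
    delta₃ (r • C) a b c = r • delta₃ C a b c := by
  simp only [delta₃]
  rw [smul_finsum' _ (finite_support_delta₃ hC _ _ _)]
  exact finsum_congr fun i => smul_comm _ _ _

lemma IterLaurent.exists_coeff_eq_zero (F : IterLaurent W) :
    ∃ N : ℤ, ∀ k m, k < N → F.coeff k m = 0 := by
  refine ⟨((HahnModule.of (LaurentSeries ℂ)).symm F : HahnSeries ℤ (LaurentMod W)).order,
    fun k m hk => ?_⟩
  have h : F.coeff₀ k = 0 := HahnSeries.coeff_eq_zero_of_lt_order hk
  rw [IterLaurent.coeff, h]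
  rfl

lemma IterLaurent.coeff_add (F F' : IterLaurent W) (k m : ℤ) :
    (F + F').coeff k m = F.coeff k m + F'.coeff k m := rfl

lemma coeff_varX_smul (F : IterLaurent W) (k m : ℤ) :
    IterLaurent.coeff (varX • F) k m = F.coeff k (m - 1) := by
  have h₁ (y : LaurentMod W) :
      ((HahnModule.of ℂ).symm ((HahnSeries.single 1 1 : LaurentSeries ℂ) • y :
        HahnModule ℤ ℂ W)).coeff ((1 : ℤ) +ᵥ (m - 1)) =
      (1 : ℂ) • ((HahnModule.of ℂ).symm (y : HahnModule ℤ ℂ W)).coeff (m - 1) :=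
    HahnModule.coeff_single_smul_vadd (Γ := ℤ) (Γ' := ℤ)
  rw [vadd_eq_add, add_sub_cancel] at h₁
  refine Eq.trans ?_ ((h₁ (F.coeff₀ k)).trans (one_smul _ _))
  exact congrArg (fun y : LaurentMod W => ((HahnModule.of ℂ).symm (y : HahnModule ℤ ℂ W)).coeff m)
    (HahnModule.coeff_single_zero_smul (Γ := ℤ) (Γ' := ℤ) (R := LaurentSeries ℂ)
      (V := LaurentMod W))

lemma coeff_varX₀_smul (F : IterLaurent W) (k m : ℤ) :
    IterLaurent.coeff (varX₀ • F) k m = F.coeff (k - 1) m := by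
  have h : IterLaurent.coeff₀ (varX₀ • F) ((1 : ℤ) +ᵥ (k - 1)) =
      (1 : LaurentSeries ℂ) • (F.coeff₀ (k - 1) : LaurentMod W) :=
    HahnModule.coeff_single_smul_vadd (Γ := ℤ) (Γ' := ℤ) (R := LaurentSeries ℂ)
      (V := LaurentMod W)
  rw [vadd_eq_add, add_sub_cancel, one_smul] at h
  rw [IterLaurent.coeff, h]
  rfl

lemma polyShift_C (r : ℂ) :
    polyShift (MvPolynomial.C r) = HahnSeries.single 0 (HahnSeries.single 0 r) := by
  rw [polyShift, MvPolynomial.aeval_C, HahnSeries.algebraMap_apply',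
    PowerSeries.algebraMap_apply, HahnSeries.algebraMap_apply', PowerSeries.algebraMap_apply,
    HahnSeries.ofPowerSeries_C, HahnSeries.ofPowerSeries_C]
  rfl

/-- `x₂⁻¹ δ((x₁ - x₀) / x₂) p(x₂ + x₀, x₂) = p(x₁, x₂) x₂⁻¹ δ((x₁ - x₀) / x₂)`. -/
lemma delta₃_polyShift_smul (p : MvPolynomial (Fin 2) ℂ) (F : IterLaurent W) (a b c : ℤ) :
    delta₃ (fun k m => (polyShift p • F).coeff k m) a b c =
      polyMul p (delta₃ (fun k m => F.coeff k m) a) b c := by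
  induction p using MvPolynomial.induction_on generalizing F b c with
  | C r =>
    obtain ⟨N, hN⟩ := F.exists_coeff_eq_zero
    simp only [polyShift_C, coeff_single_smul, C_polyMul]
    exact delta₃_smul hN r a b c
  | add p q hp hq =>
    obtain ⟨N, hN⟩ := (polyShift p • F).exists_coeff_eq_zero
    obtain ⟨N', hN'⟩ := (polyShift q • F).exists_coeff_eq_zero
    rw [add_polyMul, Pi.add_apply, Pi.add_apply, ← hp, ← hq, ← delta₃_add hN hN']
    have h : polyShift (p + q) • F = polyShift p • F + polyShift q • F := by
      rw [show polyShift (p + q) = polyShift p + polyShift q from map_add _ p q]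
      exact add_smul (polyShift p) (polyShift q) F
    rw [h]
    rfl
  | mul_X p i hp =>
    obtain ⟨N, hN⟩ := F.exists_coeff_eq_zero
    -- The last variable is absorbed into the series, so the induction hypothesis is used for a
    -- series other than `F`.
    have h : polyShift (p * MvPolynomial.X i) • F =
        polyShift p • ((![varX + varX₀, varX] i : LaurentSeries (LaurentSeries ℂ)) • F) := by
      rw [smul_smul, polyShift, map_mul, MvPolynomial.aeval_X]
      rfl
    rw [h, hp, mul_polyMul]
    congr 1
    funext s t
    fin_cases i
    · have h' (k m : ℤ) : IterLaurent.coeff ((varX + varX₀) • F) k m =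
          F.coeff k (m - 1) + F.coeff (k - 1) m := by
        rw [← coeff_varX_smul, ← coeff_varX₀_smul, ← IterLaurent.coeff_add]
        exact congrArg (IterLaurent.coeff · k m) (add_smul varX varX₀ F)
      refine Eq.trans ?_ (X_zero_polyMul _ s t).symm
      rw [← delta₃_shift hN]
      exact congrArg (fun C => delta₃ C a s t) (funext₂ h')
    · refine Eq.trans ?_ (X_one_polyMul _ s t).symm
      refine finsum_congr fun j => congrArg _ ?_
      refine (coeff_varX_smul F _ _).trans ?_
      congr 1
      ring

/-- Both sides are compared through the `x₁⁻¹` coefficient of their delta series. The left side of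
`delta₁_sub_delta₂` commutes with `p`, so no direct expansion of `p(x + x₀, x)` is needed. -/
lemma subst_polyMul (p : MvPolynomial (Fin 2) ℂ) {G : ℤ → ℤ → W} (hG : IsLaurent₂ G)
    (hG' : IsLaurent₂ (polyMul p G)) : subst (polyMul p G) hG' = polyShift p • subst G hG := by
  obtain ⟨N, hN⟩ := id hG
  refine IterLaurent.ext fun k m => ?_
  rw [← delta₃_neg_one (fun k m => (subst (polyMul p G) hG').coeff k m),
    ← delta₃_neg_one (fun k m => (polyShift p • subst G hG).coeff k m), delta₃_polyShift_smul,
    ← delta₁_sub_delta₂, delta₁_polyMul p fun s t h => hN s t (Or.inr h),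
    delta₂_polyMul p fun s t h => hN s t (Or.inl h), ← Pi.sub_apply, ← Pi.sub_apply, ← polyMul_sub]
  congr 1
  funext s t
  exact delta₁_sub_delta₂ G hG k s t

end Shift

/-! ### Nonvanishing of `p(x + x₀, x)` -/

section PolyShiftNeZero

lemma coeff_aeval_varX₀_varX (p : MvPolynomial (Fin 2) ℂ) (d : Fin 2 →₀ ℕ) :
    ((MvPolynomial.aeval ![varX₀, varX] p : LaurentSeries (LaurentSeries ℂ)).coeff (d 0)).coeff
      (d 1) = p.coeff d := by
  classical
  induction p using MvPolynomial.induction_on' with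
  | monomial u a =>
    have h : (MvPolynomial.aeval ![varX₀, varX] (MvPolynomial.monomial u a) :
        LaurentSeries (LaurentSeries ℂ)) =
        HahnSeries.single (u 0 : ℤ) (HahnSeries.single (u 1 : ℤ) a) := by
      have hC : algebraMap ℂ (LaurentSeries (LaurentSeries ℂ)) a =
          HahnSeries.single 0 (HahnSeries.single 0 a) :=
        (MvPolynomial.aeval_C _ _).symm.trans (polyShift_C a)
      rw [MvPolynomial.aeval_monomial, Finsupp.prod_fintype _ _ (fun i => pow_zero _),
        Fin.prod_univ_two, hC]
      simp [varX₀, varX, HahnSeries.C_apply, HahnSeries.single_pow, HahnSeries.single_mul_single]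
    rw [h, MvPolynomial.coeff_monomial]
    split_ifs with hu
    · subst hu
      simp
    · by_cases h0 : u 0 = d 0
      · have h1 : u 1 ≠ d 1 := fun h1 => hu (Finsupp.ext fun i => by fin_cases i <;> assumption)
        rw [h0, HahnSeries.coeff_single_same, HahnSeries.coeff_single_of_ne]
        exact_mod_cast h1.symm
      · rw [HahnSeries.coeff_single_of_ne, HahnSeries.coeff_zero]
        exact_mod_cast Ne.symm h0
  | add p q hp hq =>
    rw [map_add, HahnSeries.coeff_add, HahnSeries.coeff_add, hp, hq, MvPolynomial.coeff_add]

/-- `p(x + x₀, x)` arises from `p` by the change of variables `σ`, injective because `τ` undoes it,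
followed by evaluation at `(x₀, x)`, injective because the coefficients of the polynomial remain
visible. -/
lemma polyShift_ne_zero {p : MvPolynomial (Fin 2) ℂ} (hp : p ≠ 0) : polyShift p ≠ 0 := by
  set σ : MvPolynomial (Fin 2) ℂ →ₐ[ℂ] MvPolynomial (Fin 2) ℂ :=
    MvPolynomial.aeval ![MvPolynomial.X 1 + MvPolynomial.X 0, MvPolynomial.X 1] with hσ
  set τ : MvPolynomial (Fin 2) ℂ →ₐ[ℂ] MvPolynomial (Fin 2) ℂ :=
    MvPolynomial.aeval ![MvPolynomial.X 0 - MvPolynomial.X 1, MvPolynomial.X 1] with hτ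
  have hτσ : τ.comp σ = AlgHom.id ℂ _ := by
    refine MvPolynomial.algHom_ext fun i => ?_
    fin_cases i <;> simp [hσ, hτ]
  have hfac : polyShift p = MvPolynomial.aeval ![varX₀, varX] (σ p) := by
    have h : MvPolynomial.aeval ![varX + varX₀, varX] =
        (MvPolynomial.aeval (R := ℂ) ![varX₀, varX]).comp σ := by
      refine MvPolynomial.algHom_ext fun i => ?_
      fin_cases i <;> simp [hσ]
    rw [polyShift, h]
    rfl
  intro h0
  refine hp ?_
  have hσ0 : σ p = 0 := by
    ext d
    rw [← coeff_aeval_varX₀_varX, ← hfac, h0]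
    simp
  have := congrArg (fun f => f p) hτσ
  simpa [hσ0] using this.symm

lemma inv_polyShift_smul {W : Type*} [AddCommGroup W] [Module ℂ W]
    {p : MvPolynomial (Fin 2) ℂ} (hp : p ≠ 0) (F : IterLaurent W) :
    (polyShift p)⁻¹ • polyShift p • F = F := by
  have h : (polyShift p)⁻¹ * polyShift p = 1 :=
    inv_mul_cancel₀ (G₀ := LaurentSeries (LaurentSeries ℂ)) (polyShift_ne_zero hp)
  refine (smul_smul (polyShift p)⁻¹ (polyShift p) F).trans ?_
  rw [h]
  exact one_smul (LaurentSeries (LaurentSeries ℂ)) F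

lemma polyShift_inv_smul {W : Type*} [AddCommGroup W] [Module ℂ W]
    {p : MvPolynomial (Fin 2) ℂ} (hp : p ≠ 0) (F : IterLaurent W) :
    polyShift p • (polyShift p)⁻¹ • F = F := by
  have h : polyShift p * (polyShift p)⁻¹ = 1 :=
    mul_inv_cancel₀ (G₀ := LaurentSeries (LaurentSeries ℂ)) (polyShift_ne_zero hp)
  refine (smul_smul (polyShift p) (polyShift p)⁻¹ F).trans ?_
  rw [h]
  exact one_smul (LaurentSeries (LaurentSeries ℂ)) F

lemma linearProd_ne_zero (l : List ℂˣ) : linearProd l ≠ 0 := by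
  refine List.prod_ne_zero fun h => ?_
  obtain ⟨α, -, h⟩ := List.mem_map.1 h
  have := congrArg (MvPolynomial.eval ![1, 0]) h
  simp at this

end PolyShiftNeZero

/-! ### `Y_ℰ` and the Jacobi identity -/

section VertexOperators

variable {W : Type*} [AddCommGroup W] [Module ℂ W]

lemma exists_mulSeries_eq_zero (a b : VertexOperator ℂ W) (w : W) :
    ∃ N : ℤ, ∀ s t, t < N → mulSeries a b w s t = 0 := by
  obtain ⟨N, hN⟩ := exists_coeff_eq_zero b w
  exact ⟨N, fun s t ht => by rw [mulSeries, hN t ht, map_zero]⟩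

lemma exists_mulSeriesRev_eq_zero (a b : VertexOperator ℂ W) (w : W) :
    ∃ N : ℤ, ∀ s t, s < N → mulSeriesRev a b w s t = 0 := by
  obtain ⟨N, hN⟩ := exists_coeff_eq_zero a w
  exact ⟨N, fun s t hs => by rw [mulSeriesRev, hN s hs, map_zero]⟩

lemma LocalWith.mul_left {p : MvPolynomial (Fin 2) ℂ} {a b : VertexOperator ℂ W}
    (h : LocalWith p a b) (q : MvPolynomial (Fin 2) ℂ) : LocalWith (q * p) a b := fun w => by
  rw [mul_polyMul, mul_polyMul, h w]

/-- Substituting `x₁ = x + x₀` in `q (p a b) = p (q a b)` and cancelling in the field `ℂ((x))((x₀))`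
shows that the equation for a single `q` already determines the series. This removes the dependence
on the polynomial chosen in `YE`. -/
lemma YEseries_eq_of_smul_eq {p q : MvPolynomial (Fin 2) ℂ} {a b : VertexOperator ℂ W}
    (hp : p ≠ 0) (hq : q ≠ 0) (h : LocalWith p a b) (h' : LocalWith q a b) {w : W}
    {F : IterLaurent W}
    (hF : polyShift q • F = subst (polyMul q (mulSeries a b w)) (h'.isLaurent₂ w)) :
    YEseries p a b h w = F := by
  have hpq : polyShift q • subst (polyMul p (mulSeries a b w)) (h.isLaurent₂ w) =
      polyShift p • subst (polyMul q (mulSeries a b w)) (h'.isLaurent₂ w) := by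
    rw [← subst_polyMul q (h.isLaurent₂ w) ((h.isLaurent₂ w).polyMul q),
      ← subst_polyMul p (h'.isLaurent₂ w) ((h'.isLaurent₂ w).polyMul p)]
    congr 1
    rw [← mul_polyMul, ← mul_polyMul, mul_comm]
  rw [← hF] at hpq
  have key : subst (polyMul p (mulSeries a b w)) (h.isLaurent₂ w) = polyShift p • F := by
    have hcomm : polyShift p • polyShift q • F = polyShift q • polyShift p • F :=
      (smul_smul _ _ F).trans
        ((congrArg (· • F) (mul_comm (polyShift p) (polyShift q))).trans
          (smul_smul (polyShift q) (polyShift p) F).symm)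
    rw [hcomm] at hpq
    rw [← inv_polyShift_smul hq (subst _ _), hpq, inv_polyShift_smul hq]
  rw [YEseries, key, inv_polyShift_smul hp]

/-- `Y_ℰ(a(x), x₀) b(x)` does not depend on the polynomial that computes it. -/
lemma polyShift_smul_YEseries {p q : MvPolynomial (Fin 2) ℂ} {a b : VertexOperator ℂ W}
    (hp : p ≠ 0) (hq : q ≠ 0) (h : LocalWith p a b) (h' : LocalWith q a b) (w : W) :
    polyShift q • YEseries p a b h w = subst (polyMul q (mulSeries a b w)) (h'.isLaurent₂ w) := by
  have h0 : polyShift q • YEseries q a b h' w =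
      subst (polyMul q (mulSeries a b w)) (h'.isLaurent₂ w) := by
    rw [YEseries, polyShift_inv_smul hq]
  rwa [YEseries_eq_of_smul_eq hp hq h h' h0]

lemma QuasiLocalPair.YE_eq {a b : VertexOperator ℂ W} (h : QuasiLocalPair a b) (n : ℤ) :
    YE a n b = YEwith h.choose a b h.choose_spec.2 n := dif_pos h

lemma ext_coeff {a b : VertexOperator ℂ W}
    (h : ∀ m w, HVertexOperator.coeff a m w = HVertexOperator.coeff b m w) : a = b :=
  HVertexOperator.coeff_inj (funext fun m => LinearMap.ext (h m))

/-- The series `∑ₙ c_n(x) w x₀ ^ (-n-1)`, for vertex operators `c_n(x)` that vanish for large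
`n`. -/
def generatingSeries (c : ℤ → VertexOperator ℂ W) (N : ℤ) (hc : ∀ n, N ≤ n → c n = 0) (w : W) :
    IterLaurent W :=
  HahnModule.of (LaurentSeries ℂ) <| HahnSeries.ofSuppBddBelow
    (fun k : ℤ => (c (-k - 1) w : LaurentMod W))
    ⟨-N, fun k hk => by
      by_contra h
      exact hk (by simp only; rw [hc _ (by lia)]; rfl)⟩

lemma generatingSeries_coeff (c : ℤ → VertexOperator ℂ W) (N : ℤ) (hc : ∀ n, N ≤ n → c n = 0)
    (w : W) (k m : ℤ) :
    (generatingSeries c N hc w).coeff k m = HVertexOperator.coeff (c (-k - 1)) m w := rfl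

/-- If the modes of `Y_ℰ(a(x), x₀) b(x)` are `c_n(x)`, the Jacobi identity multiplied by `q` holds
for every `q` that makes the pair local. -/
lemma QuasiLocalPair.jacobi {a b : VertexOperator ℂ W} (h : QuasiLocalPair a b)
    {q : MvPolynomial (Fin 2) ℂ} (hq : q ≠ 0) (hl : LocalWith q a b) (w : W) (i j k : ℤ) :
    delta₁ (polyMul q (mulSeries a b w)) i j k - delta₂ (polyMul q (mulSeriesRev a b w)) i j k =
      polyMul q (delta₃ (fun r t => HVertexOperator.coeff (YE a (-r - 1) b) t w) i) j k := by
  have hY : (fun r t => HVertexOperator.coeff (YE a (-r - 1) b) t w) =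
      fun r t => (YEseries h.choose a b h.choose_spec.2 w).coeff r t := by
    funext r t
    rw [h.YE_eq]
    change (YEseries h.choose a b h.choose_spec.2 w).coeff (-(-r - 1) - 1) t = _
    rw [show -(-r - 1) - 1 = r by ring]
  -- Locality puts the same element of `W((x₁, x₂))` under both delta functions.
  rw [← hl w, delta₁_sub_delta₂ _ (hl.isLaurent₂ w), hY, ← delta₃_polyShift_smul,
    polyShift_smul_YEseries h.choose_spec.1 hq _ hl]

/-- A Jacobi identity multiplied by a polynomial determines `Y_ℰ(a(x), x₀) b(x)`. -/
lemma QuasiLocalPair.YE_eq_of_jacobi {a b : VertexOperator ℂ W} (h : QuasiLocalPair a b)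
    {c : ℤ → VertexOperator ℂ W} {N : ℤ} (hc : ∀ n, N ≤ n → c n = 0)
    {p : MvPolynomial (Fin 2) ℂ} (hp : p ≠ 0)
    (hJ : ∀ w i j k,
      delta₁ (polyMul p (mulSeries a b w)) i j k - delta₂ (polyMul p (mulSeriesRev a b w)) i j k =
      polyMul p (delta₃ (fun r t => HVertexOperator.coeff (c (-r - 1)) t w) i) j k) (n : ℤ) :
    YE a n b = c n := by
  obtain ⟨q, hq, hl⟩ := id h
  -- The `p` of the Jacobi identity need not make the pair local, and `q` need not give a Jacobi
  -- identity; `p * q` does both.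
  have hpl := hl.mul_left p
  have hF (w : W) : polyShift (p * q) • generatingSeries c N hc w =
      subst (polyMul (p * q) (mulSeries a b w)) (hpl.isLaurent₂ w) := by
    refine IterLaurent.ext fun k m => ?_
    obtain ⟨N₁, hN₁⟩ := exists_mulSeries_eq_zero a b w
    obtain ⟨N₂, hN₂⟩ := exists_mulSeriesRev_eq_zero a b w
    rw [← delta₃_neg_one (fun k m => (subst _ _).coeff k m),
      ← delta₃_neg_one (fun k m => (polyShift (p * q) • generatingSeries c N hc w).coeff k m),
      delta₃_polyShift_smul, ← delta₁_sub_delta₂]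
    -- Reversing the product under `delta₂` gives each term the truncation its expansion needs, so
    -- that `q` can be pulled out and `hJ` applied.
    nth_rewrite 2 [hpl w]
    rw [delta₁_polyMul _ hN₁, delta₂_polyMul _ hN₂, ← Pi.sub_apply, ← Pi.sub_apply, ← polyMul_sub,
      mul_comm p q, mul_polyMul, mul_polyMul, polyMul_sub]
    congr 1
    funext s t
    rw [Pi.sub_apply, Pi.sub_apply, ← delta₁_polyMul _ hN₁, ← delta₂_polyMul _ hN₂]
    exact (hJ w k s t).symm
  rw [h.YE_eq]
  refine ext_coeff fun m w => ?_
  change (YEseries h.choose a b h.choose_spec.2 w).coeff (-n - 1) m = _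
  rw [YEseries_eq_of_smul_eq h.choose_spec.1 (mul_ne_zero hp hq) _ hpl (hF w),
    generatingSeries_coeff, show -(-n - 1) - 1 = n by ring]

end VertexOperators

/-! ### Homomorphic images of vertex algebras -/

section Image

variable {V V' : Type*} [AddCommGroup V] [Module ℂ V] [AddCommGroup V'] [Module ℂ V']

/-- A homomorphic image of a vertex algebra is a vertex algebra. -/
lemma IsVertexAlgebraHom.isVertexAlgebra_of_surjective {D : VertexData V} {D' : VertexData V'}
    {f : V →ₗ[ℂ] V'} (hf : IsVertexAlgebraHom D D' f) (hs : Function.Surjective f)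
    (hD : D.IsVertexAlgebra) : D'.IsVertexAlgebra where
  add_nprod u u' n v := by
    obtain ⟨u, rfl⟩ := hs u; obtain ⟨u', rfl⟩ := hs u'; obtain ⟨v, rfl⟩ := hs v
    rw [← map_add, ← hf.map_nprod, hD.add_nprod, map_add, hf.map_nprod, hf.map_nprod]
  smul_nprod r u n v := by
    obtain ⟨u, rfl⟩ := hs u; obtain ⟨v, rfl⟩ := hs v
    rw [← map_smul, ← hf.map_nprod, hD.smul_nprod, map_smul, hf.map_nprod]
  nprod_add u n v v' := by
    obtain ⟨u, rfl⟩ := hs u; obtain ⟨v', rfl⟩ := hs v'; obtain ⟨v, rfl⟩ := hs v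
    rw [← map_add, ← hf.map_nprod, hD.nprod_add, map_add, hf.map_nprod, hf.map_nprod]
  nprod_smul r u n v := by
    obtain ⟨u, rfl⟩ := hs u; obtain ⟨v, rfl⟩ := hs v
    rw [← map_smul, ← hf.map_nprod, hD.nprod_smul, map_smul, hf.map_nprod]
  truncation u v := by
    obtain ⟨u, rfl⟩ := hs u; obtain ⟨v, rfl⟩ := hs v
    obtain ⟨N, hN⟩ := hD.truncation u v
    exact ⟨N, fun n hn => by rw [← hf.map_nprod, hN n hn, map_zero]⟩
  one_nprod n v := by
    obtain ⟨v, rfl⟩ := hs v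
    rw [← hf.map_one, ← hf.map_nprod, hD.one_nprod, apply_ite f, map_zero]
  nprod_one v n hn := by
    obtain ⟨v, rfl⟩ := hs v
    rw [← hf.map_one, ← hf.map_nprod, hD.nprod_one v n hn, map_zero]
  nprod_neg_one_one v := by
    obtain ⟨v, rfl⟩ := hs v
    rw [← hf.map_one, ← hf.map_nprod, hD.nprod_neg_one_one]
  jacobi u v w a b c := by
    obtain ⟨u, rfl⟩ := hs u; obtain ⟨v, rfl⟩ := hs v; obtain ⟨w, rfl⟩ := hs w
    have nprod_zero (u : V) (n : ℤ) : D.nprod u n 0 = 0 := by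
      simpa using hD.nprod_smul 0 u n 0
    have zero_nprod (n : ℤ) (v : V) : D.nprod 0 n v = 0 := by
      simpa using hD.smul_nprod 0 0 n v
    have h := congrArg f (hD.jacobi u v w a b c)
    obtain ⟨N₁, hN₁⟩ := hD.truncation v w
    obtain ⟨N₂, hN₂⟩ := hD.truncation u w
    obtain ⟨N₃, hN₃⟩ := hD.truncation u v
    simp only [← hf.map_nprod]
    rw [map_sub] at h
    simp only [delta₁, delta₂, delta₃] at h ⊢
    simp only [← LinearMap.toAddMonoidHom_coe] at h
    -- `f` commutes with these sums because truncation in `V` makes them finite; each bound is where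
    -- the mode number reaches the corresponding `N`.
    rw [map_finsum_of_le _ (c + 1 + N₁) fun i hi => by
        rw [hN₁ _ (by lia), nprod_zero, smul_zero],
      map_finsum_of_le _ (b + 1 + N₂) fun i hi => by
        rw [hN₂ _ (by lia), nprod_zero, smul_zero],
      map_finsum_of_le _ (a + 1 + N₃) fun i hi => by
        rw [hN₃ _ (by lia), zero_nprod, smul_zero]] at h
    simpa only [map_zsmul, LinearMap.toAddMonoidHom_coe] using h

end Image

/-! ### Quasimodules and closed subspaces -/

section Quasimodule

variable {Γ V W : Type*} [Group Γ] [AddCommGroup V] [Module ℂ V] [AddCommGroup W] [Module ℂ W]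

lemma GammaLocalPair.quasiLocalPair {G : Subgroup ℂˣ} {a b : VertexOperator ℂ W}
    (h : GammaLocalPair G a b) : QuasiLocalPair a b := by
  obtain ⟨l, -, hl⟩ := h
  exact ⟨_, linearProd_ne_zero l, hl⟩

/-- The quasimodule Jacobi identity determines `Y_ℰ`, while `φ(Γ)`-locality provides the
quasi-locality without which `YE` takes its default value `0`. -/
lemma GammaVertexAlgebra.IsQuasimodule.YE_eq {D : GammaVertexAlgebra Γ V}
    {YW : V →ₗ[ℂ] VertexOperator ℂ W} (h : D.IsQuasimodule YW) (u : V) (n : ℤ) (v : V) :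
    YE (YW u) n (YW v) = YW (D.nprod u n v) := by
  obtain ⟨p, hp, hJ⟩ := h.isQuasimodule.quasiJacobi u v
  obtain ⟨N, hN⟩ := D.isVertexAlgebra.truncation u v
  exact (h.gammaLocal u v).quasiLocalPair.YE_eq_of_jacobi
    (c := fun n => YW (D.nprod u n v)) (fun n hn => by rw [hN n hn, map_zero]) hp hJ n

lemma GammaVertexAlgebra.IsQuasimodule.isClosedSubspace_range {D : GammaVertexAlgebra Γ V}
    {YW : V →ₗ[ℂ] VertexOperator ℂ W} (h : D.IsQuasimodule YW) :
    IsClosedSubspace (LinearMap.range YW) where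
  quasiLocal := by
    rintro _ ⟨u, rfl⟩ _ ⟨v, rfl⟩
    exact (h.gammaLocal u v).quasiLocalPair
  closed := by
    rintro _ ⟨u, rfl⟩ _ ⟨v, rfl⟩ n
    exact ⟨D.nprod u n v, (h.YE_eq u n v).symm⟩

lemma GammaVertexAlgebra.IsQuasimodule.isVertexAlgebraHom {D : GammaVertexAlgebra Γ V}
    {YW : V →ₗ[ℂ] VertexOperator ℂ W} (h : D.IsQuasimodule YW)
    (h1 : idOp W ∈ LinearMap.range YW) :
    IsVertexAlgebraHom D.toVertexData
      (subspaceData (LinearMap.range YW) h1 h.isClosedSubspace_range) YW.rangeRestrict where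
  map_one := Subtype.ext h.isQuasimodule.vacuum
  map_nprod u n v := Subtype.ext (h.YE_eq u n v).symm

end Quasimodule

end VAlg

end

theorem proposition2p11 {Γ V W : Type*} [Group Γ] [AddCommGroup V] [Module ℂ V]
    [AddCommGroup W] [Module ℂ W] (D : VAlg.GammaVertexAlgebra Γ V)
    (YW : V →ₗ[ℂ] VertexOperator ℂ W) (h1 : YW D.one = VAlg.idOp W) :
    (D.IsQuasimodule YW ↔
      VAlg.IsGammaLocal D.φ.range (LinearMap.range YW : Set (VertexOperator ℂ W)) ∧
      (∃ hU : VAlg.IsClosedSubspace (LinearMap.range YW),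
        VAlg.IsVertexAlgebraHom D.toVertexData
          (VAlg.subspaceData (LinearMap.range YW) ⟨D.one, h1⟩ hU) YW.rangeRestrict) ∧
      ∀ g v, YW (D.R g v) = VAlg.rescale (D.φ g) (YW v)) ∧
    (D.IsQuasimodule YW →
      ∃ hU : VAlg.IsClosedSubspace (LinearMap.range YW),
        (VAlg.subspaceData (LinearMap.range YW) ⟨D.one, h1⟩ hU).IsVertexAlgebra) := by
  refine ⟨⟨fun h => ⟨?_, ⟨h.isClosedSubspace_range, h.isVertexAlgebraHom _⟩, h.equivariant⟩,
    ?_⟩, fun h => ⟨h.isClosedSubspace_range, (h.isVertexAlgebraHom _).isVertexAlgebra_of_surjective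
      YW.surjective_rangeRestrict D.isVertexAlgebra⟩⟩
  · rintro _ ⟨u, rfl⟩ _ ⟨v, rfl⟩
    exact h.gammaLocal u v
  · rintro ⟨hloc, ⟨hU, hhom⟩, hequiv⟩
    refine ⟨⟨h1, fun u v => ?_⟩, hequiv, fun u v => hloc _ ⟨u, rfl⟩ _ ⟨v, rfl⟩⟩
    have huv := hloc _ ⟨u, rfl⟩ _ ⟨v, rfl⟩
    obtain ⟨l, -, hl⟩ := id huv
    have hY (n : ℤ) : YW (D.nprod u n v) = VAlg.YE (YW u) n (YW v) :=
      congrArg Subtype.val (hhom.map_nprod u n v)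
    -- The product of linear factors that makes the pair local also serves as the Jacobi multiplier.
    refine ⟨_, VAlg.linearProd_ne_zero l, fun w a b c => ?_⟩
    simp only [hY]
    exact huv.quasiLocalPair.jacobi (VAlg.linearProd_ne_zero l) hl w a b c
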